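/- Algebras are of type $(2,2,1,1,0,0)$, written $\mathbf L=(L,\wedge,\vee,{}',{}^{\sim},0,1)$, with $(L,\wedge,\vee,0,1)$ a bounded lattice; put $\Diamond x=x^{\sim\sim}$ and $\square x=x'^{\sim}$. Such an $\mathbf L$ is a *PBZ\*-lattice* if for all $a,b\in L$: - $a''=a$; $a\le b$ implies $b'\le a'$; and $a\wedge a'\le b\vee b'$; - $a\wedge a^{\sim}=0$; $a\le a^{\sim\sim}$; $a\le b$ implies $b^{\sim}\le a^{\sim}$; and $a^{\sim\prime}=a^{\sim\sim}$; - $(a\wedge a')^{\sim}\le a^{\sim}\vee\square a$; - if $a\le b$ and $a'\wedge b=0$, then $a=b$. Let $\mathbb{PBZL}^{*}$ be the class of all PBZ\*-lattices (a variety), and let $S_K(\mathbf L)=\{a\in L: a\wedge a'=0\}$. A PBZ\*-lattice $\mathbf L$ is *orthomodular* if $S_K(\mathbf L)=L$ and $b=(b\wedge a')\vee a$ whenever $a\le b$ (the Brouwer complement ${}^{\sim}$ then coincides with ${}'$), and it is an *antiortholattice* if $S_K(\mathbf L)=\{0,1\}$. Let $\mathbb{OML}$ and $\mathbb{AOL}$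 denote the classes of orthomodular PBZ\*-lattices and of antiortholattices. A *variety* is a class of algebras closed under homomorphic images, subalgebras and direct products; $V(\mathbb K)$ is the smallest variety containing $\mathbb K$, and $\mathbb V\vee\mathbb W$ is the smallest variety containing both $\mathbb V$ and $\mathbb W$. An algebra is *directly indecomposable* if it is not isomorphic to a direct product of two nontrivial algebras. Consider the identities - SDM: $(x\wedge y)^{\sim}\approx x^{\sim}\vee y^{\sim}$; - WSDM: $(x\wedge y^{\sim})^{\sim}\approx x^{\sim}\vee\Diamond y$; - J2: $x\approx\bigl(x\wedge(y\wedge y')^{\sim}\bigr)\vee\bigl(x\wedge\Diamond(y\wedge y')\bigr)$; - SK: $x\wedge\Diamond y\le\square x\vee y$. Let $\mathbb{SAOL}$ be the class of all members of $V(\mathbb{AOL})$ that satisfy SDM. Let $\mathbf D_3$ be the three-element chain $0<d<1$ with $0'=1$, $d'=d$, $1'=0$, $0^{\sim}=1$ and $d^{\sim}=1^{\sim}=0$. Let $\mathbb V_1$, $\mathbb V_2$, $\mathbb V_3$ be the classes of PBZ\*-lattices that satisfy, respectively, J2 and WSDM; J2 and SDM; J2, WSDM and SK. **Theorem.** Every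 directly indecomposable member of $\mathbb V_1$ is either orthomodular or an antiortholattice. Moreover, 1. $\mathbb V_1=\mathbb{OML}\vee V(\mathbb{AOL})$; 2. $\mathbb V_2=\mathbb{OML}\vee\mathbb{SAOL}$; 3. $\mathbb V_3=\mathbb{OML}\vee V(\mathbf D_3)$. -/

import Mathlib

universe u v w

/-- Algebras of type `(2, 2, 1, 1, 0, 0)` whose reduct to `(⊓, ⊔, ⊥, ⊤)` is a bounded lattice:
bounded lattices with two arbitrary unary operations, `kc` (written `x'` on paper) and
`bc` (written `x~` on paper). No law relating `kc` and `bc` to the lattice is imposed here. -/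
class BZAlgebra (L : Type u) extends Lattice L, BoundedOrder L where
  /-- The Kleene complement `x'`. -/
  kc : L → L
  /-- The Brouwer complement `x~`. -/
  bc : L → L

namespace BZAlgebra

/-! ### PBZ*-lattices, orthomodular lattices, antiortholattices -/

section Basic

variable (L : Type u) [BZAlgebra L]

/-- `◇x = x~~`. -/
def dia {L : Type u} [BZAlgebra L] (x : L) : L := bc (bc x)

/-- `□x = x'~`. -/
def box {L : Type u} [BZAlgebra L] (x : L) : L := bc (kc x)

/-- The reduct without `bc` is a bounded involution lattice. -/
structure IsBoundedInvolutionLattice : Prop where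
  kc_kc : ∀ a : L, kc (kc a) = a
  kc_anti : ∀ a b : L, a ≤ b → kc b ≤ kc a

/-- The reduct without `bc` is a pseudo-Kleene algebra. -/
structure IsPseudoKleene : Prop extends IsBoundedInvolutionLattice L where
  inf_kc_le_sup_kc : ∀ a b : L, a ⊓ kc a ≤ b ⊔ kc b

/-- Brouwer-Zadeh lattices. -/
structure IsBZLattice : Prop extends IsPseudoKleene L where
  inf_bc : ∀ a : L, a ⊓ bc a = ⊥
  le_bc_bc : ∀ a : L, a ≤ bc (bc a)
  bc_anti : ∀ a b : L, a ≤ b → bc b ≤ bc a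
  kc_bc : ∀ a : L, kc (bc a) = bc (bc a)

/-- BZ*-lattices. -/
structure IsBZStarLattice : Prop extends IsBZLattice L where
  star : ∀ a : L, bc (a ⊓ kc a) ≤ bc a ⊔ box a

/-- Paraorthomodularity. -/
def IsParaorthomodular : Prop :=
  ∀ a b : L, a ≤ b → kc a ⊓ b = ⊥ → a = b

/-- PBZ*-lattices: paraorthomodular BZ*-lattices. -/
structure IsPBZStarLattice : Prop extends IsBZStarLattice L where
  paraorthomodular : IsParaorthomodular L

/-- The set `S_K(L)` of Kleene-sharp elements. -/
def kleeneSharp : Set L := {a | a ⊓ kc a = ⊥}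

/-- The reduct without `bc` is an ortholattice. -/
structure IsOrtholattice : Prop extends IsBoundedInvolutionLattice L where
  kleeneSharp_eq : kleeneSharp L = Set.univ

/-- The reduct without `bc` is an orthomodular lattice. -/
structure IsOrthomodularLattice : Prop extends IsOrtholattice L where
  orthomodular : ∀ a b : L, a ≤ b → b = (b ⊓ kc a) ⊔ a

/-- Antiortholattices: PBZ*-lattices whose only Kleene-sharp elements are `0` and `1`. -/
structure IsAntiortholattice : Prop extends IsPBZStarLattice L where
  kleeneSharp_eq : kleeneSharp L = {⊥, ⊤}

/-- The strong De Morgan identity. -/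
def SDM : Prop := ∀ x y : L, bc (x ⊓ y) = bc x ⊔ bc y

/-- The weak strong De Morgan identity. -/
def WSDM : Prop := ∀ x y : L, bc (x ⊓ bc y) = bc x ⊔ dia y

/-- The identity J2. -/
def J2 : Prop := ∀ x y : L, x = (x ⊓ bc (y ⊓ kc y)) ⊔ (x ⊓ dia (y ⊓ kc y))

/-- The identity SK, `x ∧ ◇y ≤ □x ∨ y`. -/
def SK : Prop := ∀ x y : L, x ⊓ dia y ≤ box x ⊔ y

end Basic

/-! ### Homomorphisms and products -/

/-- Homomorphisms of algebras of type `(2, 2, 1, 1, 0, 0)`. -/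
structure Hom (L : Type u) (M : Type v) [BZAlgebra L] [BZAlgebra M]
    extends BoundedLatticeHom L M where
  map_kc : ∀ a : L, toFun (kc a) = kc (toFun a)
  map_bc : ∀ a : L, toFun (bc a) = bc (toFun a)

instance {L : Type u} {M : Type v} [BZAlgebra L] [BZAlgebra M] :
    CoeFun (Hom L M) (fun _ => L → M) := ⟨fun f => f.toFun⟩

/-- Direct products, with coordinatewise operations. -/
instance instPi {ι : Type v} {A : ι → Type w} [∀ i, BZAlgebra (A i)] :
    BZAlgebra (∀ i, A i) where
  kc x := fun i => kc (x i)
  bc x := fun i => bc (x i)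

/-- Binary direct products, with coordinatewise operations. -/
instance instProd {L : Type u} {M : Type v} [BZAlgebra L] [BZAlgebra M] :
    BZAlgebra (L × M) where
  kc x := (kc x.1, kc x.2)
  bc x := (bc x.1, bc x.2)

/-! ### Classes of algebras and varieties -/

/-- Bundled algebras. -/
structure Alg : Type (u + 1) where
  carrier : Type u
  [str : BZAlgebra carrier]

instance : CoeSort Alg.{u} (Type u) := ⟨Alg.carrier⟩

instance (A : Alg.{u}) : BZAlgebra A := A.str

/-- A class of algebras is a variety if it is closed under homomorphic images, (isomorphic copies
of) subalgebras, and direct products of arbitrary families. -/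
structure IsVariety (K : Set Alg.{u}) : Prop where
  hom : ∀ A ∈ K, ∀ (B : Alg.{u}) (f : Hom A B), Function.Surjective f → B ∈ K
  sub : ∀ A ∈ K, ∀ (B : Alg.{u}) (f : Hom B A), Function.Injective f → B ∈ K
  prod : ∀ (ι : Type u) (A : ι → Alg.{u}), (∀ i, A i ∈ K) → Alg.mk (∀ i, A i) ∈ K

/-- `V(K)`: the variety generated by `K`, i.e. the smallest variety containing `K`. -/
def generatedVariety (K : Set Alg.{u}) : Set Alg.{u} :=
  {A | ∀ W : Set Alg.{u}, IsVariety W → K ⊆ W → A ∈ W}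

/-- The varietal join: the smallest variety containing both classes. -/
def varietalJoin (K₁ K₂ : Set Alg.{u}) : Set Alg.{u} := generatedVariety (K₁ ∪ K₂)

/-- `A` is directly indecomposable: in every isomorphism of `A` with a binary direct product,
one of the factors is trivial. -/
def DirectlyIndecomposable (A : Alg.{u}) : Prop :=
  ∀ (B C : Alg.{u}) (f : Hom A (B × C)), Function.Bijective f → Subsingleton B ∨ Subsingleton C

/-- PBZ*-lattices. -/
def PBZL : Set Alg.{u} := {A | IsPBZStarLattice A}

/-- Orthomodular lattices, as PBZ*-lattices. (In a PBZ*-lattice with orthomodular reduct the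
Brouwer complement necessarily coincides with the Kleene complement.) -/
def OML : Set Alg.{u} := {A | IsPBZStarLattice A ∧ IsOrthomodularLattice A}

/-- Antiortholattices. -/
def AOL : Set Alg.{u} := {A | IsAntiortholattice A}

/-- The subvariety of `V(AOL)` axiomatised, relative to `V(AOL)`, by SDM. -/
def SAOL : Set Alg.{u} := {A | A ∈ generatedVariety AOL.{u} ∧ SDM A}

/-- The three-element Kleene chain `0 < d < 1` with the trivial Brouwer complement
(`0~ = 1`, and `x~ = 0` for `x ≠ 0`). -/
instance instFinThree : BZAlgebra (Fin 3) where
  kc x := Fin.rev x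
  bc x := if x = 0 then 2 else 0

instance instULift {L : Type u} [BZAlgebra L] : BZAlgebra (ULift.{v} L) where
  kc x := ⟨kc x.down⟩
  bc x := ⟨bc x.down⟩

/-- The three-element antiortholattice chain `D₃` (in every universe). -/
def D3 : Alg.{u} := Alg.mk (ULift.{u} (Fin 3))

/-- PBZ*-lattices satisfying J2 and WSDM. -/
def V1 : Set Alg.{u} := {A | A ∈ PBZL.{u} ∧ J2 A ∧ WSDM A}

/-- PBZ*-lattices satisfying J2 and SDM. -/
def V2 : Set Alg.{u} := {A | A ∈ PBZL.{u} ∧ J2 A ∧ SDM A}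

/-- PBZ*-lattices satisfying J2, WSDM and SK. -/
def V3 : Set Alg.{u} := {A | A ∈ PBZL.{u} ∧ J2 A ∧ WSDM A ∧ SK A}

end BZAlgebra

/-! Under J2 and WSDM, each `y` yields a pair `e = ◇(y ∧ y')`, `f = (y ∧ y')~` of complementary
central elements: J2 splits every `a` as `(a ∧ e) ∨ (a ∧ f)`, and WSDM makes the splitting
compatible with `~` (`IsBZLattice.centralPair`). The algebra is then the product of the principal
ideals of `e` and `f`, so direct indecomposability forces `e = 0` or `f = 0`. If every `y ∧ y'` is
`0`, paraorthomodularity gives orthomodularity. Otherwise some `z = c ∧ c'` has `z~ = 0`; for sharp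
`a` the pair attached to `z ∧ a` is `(a, a')`, hence `a` is `0` or `1`.

For the varieties, a Zorn argument embeds each algebra in a product of directly indecomposable
quotients, so only orthomodular lattices and antiortholattices need checking; SK leaves an
antiortholattice at most three elements. The converse inclusions need the classes to be varieties,
which rests on replacing paraorthomodularity by the inequality `DiaOrthomodular`. -/

namespace BZAlgebra

/-! ### Homomorphisms -/

namespace Hom

variable {L : Type u} {M : Type v} [BZAlgebra L] [BZAlgebra M] (f : Hom L M)

theorem apply_inf (a b : L) : f (a ⊓ b) = f a ⊓ f b := f.map_inf' a b

theorem apply_sup (a b : L) : f (a ⊔ b) = f a ⊔ f b := f.map_sup' a b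

theorem apply_kc (a : L) : f (kc a) = kc (f a) := f.map_kc a

theorem apply_bc (a : L) : f (bc a) = bc (f a) := f.map_bc a

theorem apply_bot : f ⊥ = ⊥ := f.map_bot'

theorem apply_top : f ⊤ = ⊤ := f.map_top'

/-- The composite of two homomorphisms. -/
def comp {N : Type w} [BZAlgebra N] (g : Hom M N) (f : Hom L M) : Hom L N where
  toFun x := g (f x)
  map_sup' a b := by rw [apply_sup, apply_sup]
  map_inf' a b := by rw [apply_inf, apply_inf]
  map_top' := by rw [apply_top, apply_top]
  map_bot' := by rw [apply_bot, apply_bot]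
  map_kc a := by rw [apply_kc, apply_kc]
  map_bc a := by rw [apply_bc, apply_bc]

/-- The first projection of a binary product. -/
def fst : Hom (L × M) L where
  toFun x := x.1
  map_sup' _ _ := rfl
  map_inf' _ _ := rfl
  map_top' := rfl
  map_bot' := rfl
  map_kc _ := rfl
  map_bc _ := rfl

/-- The second projection of a binary product. -/
def snd : Hom (L × M) M where
  toFun x := x.2
  map_sup' _ _ := rfl
  map_inf' _ _ := rfl
  map_top' := rfl
  map_bot' := rfl
  map_kc _ := rfl
  map_bc _ := rfl

/-- The homomorphism into a product given by its components. -/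
def pi {ι : Type w} {A : ι → Type v} [∀ i, BZAlgebra (A i)] (f : ∀ i, Hom L (A i)) :
    Hom L (∀ i, A i) where
  toFun x := fun i => f i x
  map_sup' a b := funext fun i => (f i).apply_sup a b
  map_inf' a b := funext fun i => (f i).apply_inf a b
  map_top' := funext fun i => (f i).apply_top
  map_bot' := funext fun i => (f i).apply_bot
  map_kc a := funext fun i => (f i).apply_kc a
  map_bc a := funext fun i => (f i).apply_bc a

/-- The projections of a product. -/
def eval {ι : Type w} {A : ι → Type v} [∀ i, BZAlgebra (A i)] (i : ι) :
    Hom (∀ i, A i) (A i) where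
  toFun x := x i
  map_sup' _ _ := rfl
  map_inf' _ _ := rfl
  map_top' := rfl
  map_bot' := rfl
  map_kc _ := rfl
  map_bc _ := rfl

end Hom

/-! ### Terms and equational classes -/

/-- Terms in two variables. -/
inductive Term : Type
  | x : Term
  | y : Term
  | bot : Term
  | inf : Term → Term → Term
  | sup : Term → Term → Term
  | kleene : Term → Term
  | brouwer : Term → Term

namespace Term

/-- The value of a term. -/
def eval {L : Type u} [BZAlgebra L] (a b : L) : Term → L
  | x => a
  | y => b
  | bot => ⊥
  | inf s t => eval a b s ⊓ eval a b t
  | sup s t => eval a b s ⊔ eval a b t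
  | kleene s => BZAlgebra.kc (eval a b s)
  | brouwer s => BZAlgebra.bc (eval a b s)

theorem map_eval {L : Type u} {M : Type v} [BZAlgebra L] [BZAlgebra M] (f : Hom L M) (a b : L)
    (t : Term) : f (t.eval a b) = t.eval (f a) (f b) := by
  induction t with
  | x => rfl
  | y => rfl
  | bot => exact f.apply_bot
  | inf s t hs ht => simp only [eval, Hom.apply_inf, hs, ht]
  | sup s t hs ht => simp only [eval, Hom.apply_sup, hs, ht]
  | kleene s hs => simp only [eval, Hom.apply_kc, hs]
  | brouwer s hs => simp only [eval, Hom.apply_bc, hs]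

end Term

/-- The validity of the inequality `s ≤ t`. -/
def Satisfies (L : Type u) [BZAlgebra L] (e : Term × Term) : Prop :=
  ∀ a b : L, e.1.eval a b ≤ e.2.eval a b

/-- The class of the algebras that satisfy a set of inequalities. -/
def models (E : Set (Term × Term)) : Set Alg.{u} := {A | ∀ e ∈ E, Satisfies A e}

theorem isVariety_models (E : Set (Term × Term)) : IsVariety (models.{u} E) where
  hom A hA B f hf e he a b := by
    obtain ⟨a, rfl⟩ := hf a
    obtain ⟨b, rfl⟩ := hf b
    have h := hA e he a b
    -- As the equation `s ⊓ t = s`, the inequality passes along a homomorphism.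
    rw [← inf_eq_left] at h ⊢
    rw [← Term.map_eval, ← Term.map_eval, ← Hom.apply_inf, h]
  sub A hA B f hf e he a b := by
    have h := hA e he (f a) (f b)
    rw [← inf_eq_left] at h ⊢
    rw [← Term.map_eval, ← Term.map_eval, ← Hom.apply_inf] at h
    exact hf h
  prod ι A hA e he a b := by
    intro i
    have h := hA i e he (a i) (b i)
    have h1 := Term.map_eval (Hom.eval (A := fun i => (A i).carrier) i) a b e.1
    have h2 := Term.map_eval (Hom.eval (A := fun i => (A i).carrier) i) a b e.2
    exact h1.le.trans (h.trans h2.ge)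

theorem IsVariety.inter {K₁ K₂ : Set Alg.{u}} (h₁ : IsVariety K₁) (h₂ : IsVariety K₂) :
    IsVariety (K₁ ∩ K₂) where
  hom A hA B f hf := ⟨h₁.hom A hA.1 B f hf, h₂.hom A hA.2 B f hf⟩
  sub A hA B f hf := ⟨h₁.sub A hA.1 B f hf, h₂.sub A hA.2 B f hf⟩
  prod ι A hA := ⟨h₁.prod ι A fun i => (hA i).1, h₂.prod ι A fun i => (hA i).2⟩

theorem subset_generatedVariety (K : Set Alg.{u}) : K ⊆ generatedVariety K :=
  fun _ hA _ _ hK => hK hA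

theorem generatedVariety_subset {K W : Set Alg.{u}} (hW : IsVariety W) (h : K ⊆ W) :
    generatedVariety K ⊆ W := fun _ hA => hA W hW h

theorem isVariety_generatedVariety (K : Set Alg.{u}) : IsVariety (generatedVariety K) where
  hom A hA B f hf W hW h := hW.hom A (hA W hW h) B f hf
  sub A hA B f hf W hW h := hW.sub A (hA W hW h) B f hf
  prod ι A hA W hW h := hW.prod ι A fun i => hA i W hW h

/-! ### Arithmetic of bounded involution lattices and BZ-lattices -/

section Arithmetic

variable {L : Type u} [BZAlgebra L]

namespace IsBoundedInvolutionLattice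

theorem kc_sup (h : IsBoundedInvolutionLattice L) (a b : L) : kc (a ⊔ b) = kc a ⊓ kc b := by
  refine le_antisymm (le_inf (h.kc_anti _ _ le_sup_left) (h.kc_anti _ _ le_sup_right)) ?_
  rw [← h.kc_kc (kc a ⊓ kc b)]
  refine h.kc_anti _ _ (sup_le ?_ ?_)
  · conv_lhs => rw [← h.kc_kc a]
    exact h.kc_anti _ _ inf_le_left
  · conv_lhs => rw [← h.kc_kc b]
    exact h.kc_anti _ _ inf_le_right

theorem kc_inf (h : IsBoundedInvolutionLattice L) (a b : L) : kc (a ⊓ b) = kc a ⊔ kc b := by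
  rw [← h.kc_kc (kc a ⊔ kc b), h.kc_sup, h.kc_kc, h.kc_kc]

theorem kc_bot (h : IsBoundedInvolutionLattice L) : kc (⊥ : L) = ⊤ := by
  refine top_le_iff.1 ?_
  rw [← h.kc_kc ⊤]
  exact h.kc_anti _ _ bot_le

theorem kc_top (h : IsBoundedInvolutionLattice L) : kc (⊤ : L) = ⊥ := by
  rw [← h.kc_bot, h.kc_kc]

end IsBoundedInvolutionLattice

namespace IsBZLattice

theorem bc_bc_bc (h : IsBZLattice L) (a : L) : bc (bc (bc a)) = bc a :=
  le_antisymm (h.bc_anti _ _ (h.le_bc_bc a)) (h.le_bc_bc _)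

theorem bc_top (h : IsBZLattice L) : bc (⊤ : L) = ⊥ := by
  simpa using h.inf_bc ⊤

theorem bc_bot (h : IsBZLattice L) : bc (⊥ : L) = ⊤ := by
  refine top_le_iff.1 ((h.le_bc_bc ⊤).trans ?_)
  rw [h.bc_top]

theorem kc_dia (h : IsBZLattice L) (a : L) : kc (dia a) = bc a := by
  rw [dia, h.kc_bc, h.bc_bc_bc]

theorem bc_le_kc (h : IsBZLattice L) (a : L) : bc a ≤ kc a := by
  rw [← h.kc_dia]
  exact h.kc_anti _ _ (h.le_bc_bc a)

theorem box_le (h : IsBZLattice L) (a : L) : box a ≤ a :=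
  (h.bc_le_kc _).trans (h.kc_kc a).le

theorem eq_bot_of_bc_eq_top (h : IsBZLattice L) {a : L} (ha : bc a = ⊤) : a = ⊥ := by
  simpa [ha] using h.inf_bc a

end IsBZLattice

/-- Orthomodularity of the Brouwer-closed elements. -/
def DiaOrthomodular (L : Type u) [BZAlgebra L] : Prop :=
  ∀ a b : L, (bc a ⊔ (dia a ⊓ dia b)) ⊓ dia a ≤ dia b

/-- With `r = ◇a ∧ ◇b`, the element `u = ◇a ∧ r'` is Brouwer-closed, hence sharp. Then `r ≤ (a~ ∨ r)
∧ ◇a`, and the meet of the right side with `r'` is `u ∧ u' = 0`, so paraorthomodularity makes the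
two sides equal. -/
theorem IsPBZStarLattice.diaOrthomodular (h : IsPBZStarLattice L) : DiaOrthomodular L := by
  intro a b
  have hr : dia (dia a ⊓ dia b) = dia a ⊓ dia b := by
    refine le_antisymm (le_inf ?_ ?_) (h.le_bc_bc _)
    · exact (h.bc_anti _ _ (h.bc_anti _ _ inf_le_left)).trans (h.bc_bc_bc _).le
    · exact (h.bc_anti _ _ (h.bc_anti _ _ inf_le_right)).trans (h.bc_bc_bc _).le
  set r := dia a ⊓ dia b with hrdef
  have hu : dia (dia a ⊓ kc r) = dia a ⊓ kc r := by
    rw [← hr, h.kc_dia]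
    refine le_antisymm (le_inf ?_ ?_) (h.le_bc_bc _)
    · exact (h.bc_anti _ _ (h.bc_anti _ _ inf_le_left)).trans (h.bc_bc_bc _).le
    · exact (h.bc_anti _ _ (h.bc_anti _ _ inf_le_right)).trans (h.bc_bc_bc _).le
  have hu' : kc (dia a ⊓ kc r) = bc a ⊔ r := by rw [h.kc_inf, h.kc_kc, h.kc_dia]
  have hu0 : (dia a ⊓ kc r) ⊓ (bc a ⊔ r) = ⊥ := by
    rw [← hu', ← hu, h.kc_dia, hu]
    exact h.inf_bc _
  have key : r = (bc a ⊔ r) ⊓ dia a := by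
    refine h.paraorthomodular _ _ (le_inf le_sup_right inf_le_left) ?_
    rw [← hu0]
    ac_rfl
  rw [← key]
  exact inf_le_right

/-- In a BZ*-lattice with orthomodular Brouwer-closed part, Kleene-sharp elements are closed. -/
theorem IsBZStarLattice.dia_eq_of_sharp (h : IsBZStarLattice L) (hd : DiaOrthomodular L) {a : L}
    (ha : a ⊓ kc a = ⊥) : dia a = a := by
  refine le_antisymm ?_ (h.le_bc_bc a)
  have h1 : bc a ⊔ box a = ⊤ := by
    refine top_le_iff.1 ?_
    rw [← h.bc_bot, ← ha]
    exact h.star a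
  have h2 : dia (box a) = box a := h.bc_bc_bc _
  -- As `□a ≤ ◇a` and `a~ ∨ □a = 1`, this instance reads `◇a ≤ □a`.
  have h3 := hd a (box a)
  rw [h2, inf_eq_right.2 (show box a ≤ dia a from (h.box_le a).trans (h.le_bc_bc a)), h1, top_inf_eq] at h3
  exact h3.trans (h.box_le a)

/-- If `a ≤ b` and `a' ∧ b = 0`, both `a ∧ a'` and `b ∧ b'` lie below `a' ∧ b`, so `a` and `b` are
sharp and therefore closed, which brings them within reach of the inequality. -/
theorem IsBZStarLattice.isPBZStarLattice (h : IsBZStarLattice L) (hd : DiaOrthomodular L) :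
    IsPBZStarLattice L := by
  refine { h with paraorthomodular := fun a b hab h0 => le_antisymm hab ?_ }
  have ha : dia a = a := h.dia_eq_of_sharp hd <| by
    rw [eq_bot_iff, ← h0, inf_comm]
    exact inf_le_inf_left _ hab
  have hb : dia b = b := h.dia_eq_of_sharp hd <| by
    rw [eq_bot_iff, ← h0, inf_comm]
    exact inf_le_inf_right _ (h.kc_anti _ _ hab)
  have h1 : bc b ⊔ a = ⊤ := by
    rw [← h.kc_dia, hb, ← h.kc_bot, ← h0, h.kc_inf, h.kc_kc, sup_comm]
  have h2 := hd b a
  rwa [ha, hb, inf_eq_right.2 hab, h1, top_inf_eq] at h2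

theorem IsPBZStarLattice.dia_eq_of_sharp (h : IsPBZStarLattice L) {a : L}
    (ha : a ⊓ kc a = ⊥) : dia a = a :=
  h.toIsBZStarLattice.dia_eq_of_sharp h.diaOrthomodular ha

theorem IsPBZStarLattice.bc_eq_kc_of_sharp (h : IsPBZStarLattice L) {a : L}
    (ha : a ⊓ kc a = ⊥) : bc a = kc a := by
  rw [← h.kc_dia, h.dia_eq_of_sharp ha]

theorem SDM.wsdm (h : SDM L) : WSDM L := fun x y => h x (bc y)

theorem IsPBZStarLattice.isOrthomodularLattice (h : IsPBZStarLattice L)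
    (hs : ∀ a : L, a ⊓ kc a = ⊥) : IsOrthomodularLattice L where
  toIsBoundedInvolutionLattice := h.toIsBoundedInvolutionLattice
  kleeneSharp_eq := Set.eq_univ_of_forall hs
  orthomodular a b hab := by
    -- The remaining meet is `(b ∧ a')' ∧ a' ∧ b`, which is `0` since `b ∧ a'` is sharp.
    refine (h.paraorthomodular _ _ (sup_le inf_le_left hab) ?_).symm
    rw [h.kc_sup, ← hs (b ⊓ kc a)]
    ac_rfl

/-! ### Identities of orthomodular lattices and antiortholattices -/

theorem IsOrtholattice.sharp (h : IsOrtholattice L) (a : L) : a ⊓ kc a = ⊥ := by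
  have : a ∈ kleeneSharp L := h.kleeneSharp_eq ▸ Set.mem_univ a
  exact this

section Ortho

variable (hp : IsPBZStarLattice L) (ho : IsOrtholattice L)
include hp ho

theorem IsPBZStarLattice.bc_eq_kc (a : L) : bc a = kc a := hp.bc_eq_kc_of_sharp (ho.sharp a)

theorem IsPBZStarLattice.sdm_of_isOrtholattice : SDM L := fun x y => by
  simp only [hp.bc_eq_kc ho, hp.kc_inf]

theorem IsPBZStarLattice.j2_of_isOrtholattice : J2 L := fun x y => by
  rw [ho.sharp, dia, hp.bc_bot, hp.bc_top]
  simp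

theorem IsPBZStarLattice.sk_of_isOrtholattice : SK L := fun x y => by
  rw [hp.dia_eq_of_sharp (ho.sharp y)]
  exact inf_le_right.trans le_sup_right

end Ortho

namespace IsAntiortholattice

variable (h : IsAntiortholattice L)
include h

theorem eq_bot_or_eq_top {a : L} (ha : a ⊓ kc a = ⊥) : a = ⊥ ∨ a = ⊤ := by
  have h1 : a ∈ kleeneSharp L := ha
  rw [h.kleeneSharp_eq] at h1
  exact h1

theorem bc_eq_bot_or_eq_top (a : L) : bc a = ⊥ ∨ bc a = ⊤ :=
  h.eq_bot_or_eq_top <| by rw [h.kc_bc, h.inf_bc]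

theorem bc_eq_bot {a : L} (ha : a ≠ ⊥) : bc a = ⊥ :=
  (h.bc_eq_bot_or_eq_top a).resolve_right fun h1 => ha (h.eq_bot_of_bc_eq_top h1)

theorem wsdm : WSDM L := fun x y => by
  rcases h.bc_eq_bot_or_eq_top y with h1 | h1 <;> simp [dia, h1, h.bc_bot, h.bc_top]

theorem j2 : J2 L := fun x y => by
  rcases h.bc_eq_bot_or_eq_top (y ⊓ kc y) with h1 | h1 <;> simp [dia, h1, h.bc_bot, h.bc_top]

/-- Here `◇b = 1` and `□a = 0`, so SK collapses to `a ≤ b`. -/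
theorem le_of_sk (hk : SK L) {a b : L} (ha : a ≠ ⊤) (hb : b ≠ ⊥) : a ≤ b := by
  have h1 := hk a b
  have h2 : kc a ≠ ⊥ := fun h0 => ha (by rw [← h.kc_kc a, h0, h.kc_bot])
  simpa [dia, box, h.bc_eq_bot hb, h.bc_eq_bot h2, h.bc_bot] using h1

end IsAntiortholattice

end Arithmetic

/-! ### Equational axiomatisations -/

section Equational

open Term

/-- The identities of PBZ*-lattices, as inequalities. -/
def pbzIdentities : Set (Term × Term) :=
  {(x, kleene (kleene x)), (kleene (kleene x), x), (kleene (sup x y), kleene x),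
    (inf x (kleene x), sup y (kleene y)), (inf x (brouwer x), bot), (x, brouwer (brouwer x)),
    (brouwer (sup x y), brouwer x),
    (kleene (brouwer x), brouwer (brouwer x)), (brouwer (brouwer x), kleene (brouwer x)),
    (brouwer (inf x (kleene x)), sup (brouwer x) (brouwer (kleene x))),
    (inf (sup (brouwer x) (inf (brouwer (brouwer x)) (brouwer (brouwer y)))) (brouwer (brouwer x)), brouwer (brouwer y))}

/-- The conditional axioms become inequalities: order reversal by comparing `x` with `x ∨ y`,
paraorthomodularity through `DiaOrthomodular`. -/
theorem PBZL_eq_models : PBZL.{u} = models pbzIdentities := by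
  ext A
  simp only [models, pbzIdentities, Set.mem_insert_iff, Set.mem_singleton_iff,
    forall_eq_or_imp, forall_eq, Satisfies, Term.eval, Set.mem_ofPred_eq]
  constructor
  · intro h
    have h : IsPBZStarLattice A := h
    exact ⟨fun a _ => (h.kc_kc a).ge, fun a _ => (h.kc_kc a).le,
      fun a b => h.kc_anti _ _ le_sup_left, h.inf_kc_le_sup_kc, fun a _ => (h.inf_bc a).le,
      fun a _ => h.le_bc_bc a, fun a b => h.bc_anti _ _ le_sup_left,
      fun a _ => (h.kc_bc a).le, fun a _ => (h.kc_bc a).ge, fun a _ => h.star a,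
      h.diaOrthomodular⟩
  · rintro ⟨h1, h2, h3, h4, h5, h6, h7, h8, h9, h10, h11⟩
    have h : IsBZStarLattice A :=
      { kc_kc := fun a => le_antisymm (h2 a a) (h1 a a)
        kc_anti := fun a b hab => by have h0 := h3 a b; rwa [sup_eq_right.2 hab] at h0
        inf_kc_le_sup_kc := h4
        inf_bc := fun a => le_bot_iff.1 (h5 a a)
        le_bc_bc := fun a => h6 a a
        bc_anti := fun a b hab => by have h0 := h7 a b; rwa [sup_eq_right.2 hab] at h0
        kc_bc := fun a => le_antisymm (h8 a a) (h9 a a)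
        star := fun a => h10 a a }
    exact h.isPBZStarLattice h11

theorem isVariety_PBZL : IsVariety PBZL.{u} := by
  rw [PBZL_eq_models]
  exact isVariety_models _

theorem isVariety_setOf_eq (s t : Term) :
    IsVariety {A : Alg.{u} | ∀ a b : A, s.eval a b = t.eval a b} := by
  have h := isVariety_models.{u} {(s, t), (t, s)}
  convert h using 1
  ext A
  simp only [models, Set.mem_insert_iff, Set.mem_singleton_iff, forall_eq_or_imp, forall_eq,
    Satisfies, Set.mem_ofPred_eq]
  exact ⟨fun h => ⟨fun a b => (h a b).le, fun a b => (h a b).ge⟩,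
    fun h a b => le_antisymm (h.1 a b) (h.2 a b)⟩

theorem isVariety_SDM : IsVariety {A : Alg.{u} | SDM A} :=
  isVariety_setOf_eq (brouwer (inf x y)) (sup (brouwer x) (brouwer y))

theorem isVariety_WSDM : IsVariety {A : Alg.{u} | WSDM A} :=
  isVariety_setOf_eq (brouwer (inf x (brouwer y))) (sup (brouwer x) (brouwer (brouwer y)))

theorem isVariety_J2 : IsVariety {A : Alg.{u} | J2 A} :=
  isVariety_setOf_eq x
    (sup (inf x (brouwer (inf y (kleene y)))) (inf x (brouwer (brouwer (inf y (kleene y))))))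

theorem isVariety_SK : IsVariety {A : Alg.{u} | SK A} := by
  have h := isVariety_models.{u} {(inf x (brouwer (brouwer y)), sup (brouwer (kleene x)) y)}
  convert h using 1
  ext A
  simp only [models, Set.mem_singleton_iff, forall_eq, Satisfies, Set.mem_ofPred_eq]
  rfl

theorem isVariety_V1 : IsVariety V1.{u} :=
  isVariety_PBZL.inter (isVariety_J2.inter isVariety_WSDM)

theorem isVariety_V2 : IsVariety V2.{u} :=
  isVariety_PBZL.inter (isVariety_J2.inter isVariety_SDM)

theorem isVariety_V3 : IsVariety V3.{u} :=
  isVariety_PBZL.inter (isVariety_J2.inter (isVariety_WSDM.inter isVariety_SK))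

end Equational

/-! ### Central elements and direct decompositions -/

/-- A complementary pair of central elements. -/
structure CentralPair {L : Type u} [BZAlgebra L] (e f : L) : Prop where
  kc_left : kc e = f
  kc_right : kc f = e
  inf_eq_bot : e ⊓ f = ⊥
  eq_sup : ∀ a : L, a = (a ⊓ e) ⊔ (a ⊓ f)
  bc_inf_left : ∀ a : L, bc (a ⊓ e) = bc a ⊔ f
  bc_inf_right : ∀ a : L, bc (a ⊓ f) = bc a ⊔ e

/-- The principal ideal of `e`, with the complements relativised to `e`. -/
abbrev ideal {L : Type u} [BZAlgebra L] (e : L) : BZAlgebra (Set.Iic e) where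
  kc x := ⟨kc x.1 ⊓ e, inf_le_right⟩
  bc x := ⟨bc x.1 ⊓ e, inf_le_right⟩

namespace CentralPair

variable {L : Type u} [BZAlgebra L] {e f : L}

theorem symm (h : CentralPair e f) : CentralPair f e where
  kc_left := h.kc_right
  kc_right := h.kc_left
  inf_eq_bot := by rw [inf_comm, h.inf_eq_bot]
  eq_sup a := by rw [sup_comm, ← h.eq_sup]
  bc_inf_left := h.bc_inf_right
  bc_inf_right := h.bc_inf_left

variable (hL : IsBoundedInvolutionLattice L) (h : CentralPair e f)
include hL h

theorem sup_inf_eq {s t : L} (hs : s ≤ e) (ht : t ≤ f) : (s ⊔ t) ⊓ e = s := by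
  refine le_antisymm ?_ (le_inf le_sup_left hs)
  -- The Kleene complement dualises the splitting `eq_sup`.
  have h1 : s = (s ⊔ f) ⊓ (s ⊔ e) := by
    have h2 := congrArg kc (h.eq_sup (kc s))
    rwa [hL.kc_sup, hL.kc_inf, hL.kc_inf, hL.kc_kc, h.kc_left, h.kc_right] at h2
  conv_rhs => rw [h1]
  exact inf_le_inf (sup_le_sup_left ht _) le_sup_right

theorem sup_inf_distrib (a b : L) : (a ⊔ b) ⊓ e = (a ⊓ e) ⊔ (b ⊓ e) := by
  have h1 : a ⊔ b = ((a ⊓ e) ⊔ (b ⊓ e)) ⊔ ((a ⊓ f) ⊔ (b ⊓ f)) := by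
    conv_lhs => rw [h.eq_sup a, h.eq_sup b]
    ac_rfl
  rw [h1]
  exact h.sup_inf_eq hL (sup_le inf_le_right inf_le_right) (sup_le inf_le_right inf_le_right)

theorem sup_right_inf (a : L) : (a ⊔ f) ⊓ e = a ⊓ e := by
  rw [h.sup_inf_distrib hL, inf_comm f, h.inf_eq_bot, sup_bot_eq]

/-- The homomorphism onto the principal ideal of a central element. -/
def toIdeal : letI := ideal e; Hom L (Set.Iic e) :=
  letI := ideal e
  { toFun := fun a => ⟨a ⊓ e, inf_le_right⟩
    map_sup' := fun a b => Subtype.ext (h.sup_inf_distrib hL a b)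
    map_inf' := fun a b => Subtype.ext (inf_inf_distrib_right a b e)
    map_top' := Subtype.ext (top_inf_eq e)
    map_bot' := Subtype.ext (bot_inf_eq e)
    map_kc := fun a => Subtype.ext <| by
      change kc a ⊓ e = kc (a ⊓ e) ⊓ e
      rw [hL.kc_inf, h.kc_left, h.sup_right_inf hL]
    map_bc := fun a => Subtype.ext <| by
      change bc a ⊓ e = bc (a ⊓ e) ⊓ e
      rw [h.bc_inf_left, h.sup_right_inf hL] }

end CentralPair

/-- The homomorphism into a binary product given by its components. -/
def Hom.prod {L : Type u} {M : Type v} {N : Type w} [BZAlgebra L] [BZAlgebra M] [BZAlgebra N]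
    (f : Hom L M) (g : Hom L N) : Hom L (M × N) where
  toFun x := (f x, g x)
  map_sup' a b := Prod.ext (f.apply_sup a b) (g.apply_sup a b)
  map_inf' a b := Prod.ext (f.apply_inf a b) (g.apply_inf a b)
  map_top' := Prod.ext f.apply_top g.apply_top
  map_bot' := Prod.ext f.apply_bot g.apply_bot
  map_kc a := Prod.ext (f.apply_kc a) (g.apply_kc a)
  map_bc a := Prod.ext (f.apply_bc a) (g.apply_bc a)

theorem DirectlyIndecomposable.eq_bot_or_eq_bot {A : Alg.{u}} (hA : DirectlyIndecomposable A)
    (hL : IsBoundedInvolutionLattice A) {e f : A} (h : CentralPair e f) : e = ⊥ ∨ f = ⊥ := by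
  let := ideal e
  let := ideal f
  have key := hA (Alg.mk (Set.Iic e)) (Alg.mk (Set.Iic f))
    (Hom.prod (h.toIdeal hL) (h.symm.toIdeal hL)) ⟨?_, ?_⟩
  · refine key.imp (fun hs => ?_) (fun hs => ?_)
    · exact congrArg Subtype.val (hs.elim (⟨e, le_rfl⟩ : Set.Iic e) ⟨⊥, bot_le⟩)
    · exact congrArg Subtype.val (hs.elim (⟨f, le_rfl⟩ : Set.Iic f) ⟨⊥, bot_le⟩)
  · intro a b hab
    have h1 : a ⊓ e = b ⊓ e := congrArg (fun p => p.1.1) hab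
    have h2 : a ⊓ f = b ⊓ f := congrArg (fun p => p.2.1) hab
    rw [h.eq_sup a, h.eq_sup b, h1, h2]
  · rintro ⟨⟨s, hs⟩, ⟨t, ht⟩⟩
    refine ⟨s ⊔ t, Prod.ext (Subtype.ext ?_) (Subtype.ext ?_)⟩
    · exact h.sup_inf_eq hL hs ht
    · change (s ⊔ t) ⊓ f = t
      rw [sup_comm]
      exact h.symm.sup_inf_eq hL ht hs

theorem IsBZLattice.centralPair {L : Type u} [BZAlgebra L] (h : IsBZLattice L) (hj : J2 L)
    (hw : WSDM L) (y : L) : CentralPair (dia (y ⊓ kc y)) (bc (y ⊓ kc y)) where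
  kc_left := h.kc_dia _
  kc_right := h.kc_bc _
  inf_eq_bot := by rw [inf_comm]; exact h.inf_bc _
  eq_sup a := by rw [sup_comm]; exact hj a y
  bc_inf_left a := by
    have h1 := hw a (bc (y ⊓ kc y))
    rwa [dia, h.bc_bc_bc] at h1
  bc_inf_right a := hw a _

theorem isOrthomodularLattice_or_isAntiortholattice {A : Alg.{u}} (hA : A ∈ V1.{u})
    (hd : DirectlyIndecomposable A) : IsOrthomodularLattice A ∨ IsAntiortholattice A := by
  obtain ⟨hp, hj, hw⟩ := hA
  have hp : IsPBZStarLattice A := hp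
  have key : ∀ c : A, dia (c ⊓ kc c) = ⊥ ∨ bc (c ⊓ kc c) = ⊥ := fun c =>
    hd.eq_bot_or_eq_bot hp.toIsBoundedInvolutionLattice (hp.centralPair hj hw c)
  by_cases hs : ∀ c : A, c ⊓ kc c = ⊥
  · exact Or.inl (hp.isOrthomodularLattice hs)
  refine Or.inr { hp with kleeneSharp_eq := ?_ }
  push Not at hs
  obtain ⟨c, hc⟩ := hs
  -- `◇(c ∧ c')` lies above `c ∧ c' ≠ 0`, which rules out the other alternative.
  have hc0 : bc (c ⊓ kc c) = ⊥ := (key c).resolve_left fun h0 =>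
    hc (le_bot_iff.1 (h0 ▸ hp.le_bc_bc (c ⊓ kc c)))
  ext a
  constructor
  · intro ha
    have ha : a ⊓ kc a = ⊥ := ha
    -- Lying below its own complement, `z ∧ a` gives itself as the meet that `key` uses.
    have hz : (c ⊓ kc c ⊓ a) ⊓ kc (c ⊓ kc c ⊓ a) = c ⊓ kc c ⊓ a := by
      refine inf_eq_left.2 ?_
      rw [hp.kc_inf, hp.kc_inf, hp.kc_kc]
      exact (inf_le_left.trans inf_le_right).trans (le_sup_left.trans le_sup_left)
    have hbc : bc (c ⊓ kc c ⊓ a) = kc a := by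
      -- WSDM applies because `a = a~~` is closed.
      have h1 := hw (c ⊓ kc c) (bc a)
      have h2 : bc (bc a) = a := hp.dia_eq_of_sharp ha
      rwa [dia, h2, hc0, bot_sup_eq, hp.bc_eq_kc_of_sharp ha] at h1
    have hdia : dia (c ⊓ kc c ⊓ a) = a := by
      rw [dia, hbc, ← hp.bc_eq_kc_of_sharp ha]
      exact hp.dia_eq_of_sharp ha
    have h3 := key (c ⊓ kc c ⊓ a)
    rw [hz, hdia, hbc] at h3
    refine h3.imp id fun h0 => ?_
    change a = ⊤
    rw [← hp.kc_kc a, h0, hp.kc_bot]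
  · rintro (rfl | rfl)
    · exact bot_inf_eq _
    · change ⊤ ⊓ kc ⊤ = ⊥
      rw [hp.kc_top, inf_bot_eq]

/-! ### Congruences and quotients -/

/-- Congruences. -/
structure IsCongruence {L : Type u} [BZAlgebra L] (r : Setoid L) : Prop where
  inf : ∀ {a b c d : L}, r a b → r c d → r (a ⊓ c) (b ⊓ d)
  sup : ∀ {a b c d : L}, r a b → r c d → r (a ⊔ c) (b ⊔ d)
  kc : ∀ {a b : L}, r a b → r (kc a) (kc b)
  bc : ∀ {a b : L}, r a b → r (bc a) (bc b)

namespace IsCongruence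

variable {L : Type u} [BZAlgebra L] {r : Setoid L} (h : IsCongruence r)

theorem ker {M : Type v} [BZAlgebra M] (f : Hom L M) : IsCongruence (Setoid.ker f) where
  inf {a b c d} h1 h2 := by
    rw [Setoid.ker_def] at *
    rw [f.apply_inf, f.apply_inf, h1, h2]
  sup {a b c d} h1 h2 := by
    rw [Setoid.ker_def] at *
    rw [f.apply_sup, f.apply_sup, h1, h2]
  kc {a b} h1 := by
    rw [Setoid.ker_def] at *
    rw [f.apply_kc, f.apply_kc, h1]
  bc {a b} h1 := by
    rw [Setoid.ker_def] at *
    rw [f.apply_bc, f.apply_bc, h1]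

theorem sSup_of_isChain {C : Set (Setoid L)} (hC : IsChain (· ≤ ·) C) (hne : C.Nonempty)
    (hcong : ∀ r ∈ C, IsCongruence r) :
    ∃ s : Setoid L, IsCongruence s ∧ (∀ a b, s a b ↔ ∃ r ∈ C, r a b) := by
  -- In a chain, two related pairs are related by a single member, so the union is a congruence.
  have common : ∀ {a b c d : L}, (∃ r ∈ C, r a b) → (∃ r ∈ C, r c d) →
      ∃ r ∈ C, r a b ∧ r c d := by
    rintro a b c d ⟨r, hr, h1⟩ ⟨s, hs, h2⟩
    rcases hC.total hr hs with hrs | hsr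
    · exact ⟨s, hs, hrs h1, h2⟩
    · exact ⟨r, hr, h1, hsr h2⟩
  obtain ⟨r₀, hr₀⟩ := hne
  refine ⟨⟨fun a b => ∃ r ∈ C, r a b, fun a => ⟨r₀, hr₀, r₀.refl a⟩, ?_, ?_⟩,
    ⟨?_, ?_, ?_, ?_⟩, fun a b => Iff.rfl⟩
  · rintro a b ⟨r, hr, h1⟩
    exact ⟨r, hr, r.symm h1⟩
  · intro a b c h1 h2
    obtain ⟨r, hr, h3, h4⟩ := common h1 h2
    exact ⟨r, hr, r.trans h3 h4⟩
  · intro a b c d h1 h2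
    obtain ⟨r, hr, h3, h4⟩ := common h1 h2
    exact ⟨r, hr, (hcong r hr).inf h3 h4⟩
  · intro a b c d h1 h2
    obtain ⟨r, hr, h3, h4⟩ := common h1 h2
    exact ⟨r, hr, (hcong r hr).sup h3 h4⟩
  · rintro a b ⟨r, hr, h1⟩
    exact ⟨r, hr, (hcong r hr).kc h1⟩
  · rintro a b ⟨r, hr, h1⟩
    exact ⟨r, hr, (hcong r hr).bc h1⟩

/-- The lattice reduct of the quotient by a congruence. -/
abbrev quotientLattice : Lattice (Quotient r) :=
  letI : Max (Quotient r) := ⟨Quotient.map₂ (· ⊔ ·) fun _ _ h1 _ _ h2 => h.sup h1 h2⟩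
  letI : Min (Quotient r) := ⟨Quotient.map₂ (· ⊓ ·) fun _ _ h1 _ _ h2 => h.inf h1 h2⟩
  Lattice.mk'
    (by rintro ⟨a⟩ ⟨b⟩; exact congrArg (Quotient.mk r) (sup_comm a b))
    (by rintro ⟨a⟩ ⟨b⟩ ⟨c⟩; exact congrArg (Quotient.mk r) (sup_assoc a b c))
    (by rintro ⟨a⟩ ⟨b⟩; exact congrArg (Quotient.mk r) (inf_comm a b))
    (by rintro ⟨a⟩ ⟨b⟩ ⟨c⟩; exact congrArg (Quotient.mk r) (inf_assoc a b c))
    (by rintro ⟨a⟩ ⟨b⟩; exact congrArg (Quotient.mk r) sup_inf_self)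
    (by rintro ⟨a⟩ ⟨b⟩; exact congrArg (Quotient.mk r) inf_sup_self)

/-- The quotient by a congruence. -/
abbrev quotient : BZAlgebra (Quotient r) :=
  letI := h.quotientLattice
  { h.quotientLattice with
    top := Quotient.mk r ⊤
    bot := Quotient.mk r ⊥
    le_top := by
      rintro ⟨a⟩
      exact sup_eq_right.1 (congrArg (Quotient.mk r) (sup_top_eq a))
    bot_le := by
      rintro ⟨a⟩
      exact sup_eq_right.1 (congrArg (Quotient.mk r) (bot_sup_eq a))
    kc := Quotient.map BZAlgebra.kc fun _ _ h1 => h.kc h1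
    bc := Quotient.map BZAlgebra.bc fun _ _ h1 => h.bc h1 }

/-- The quotient homomorphism. -/
def mkHom : letI := h.quotient; Hom L (Quotient r) :=
  letI := h.quotient
  { toFun := Quotient.mk r
    map_sup' := fun _ _ => rfl
    map_inf' := fun _ _ => rfl
    map_top' := rfl
    map_bot' := rfl
    map_kc := fun _ => rfl
    map_bc := fun _ => rfl }

end IsCongruence

theorem exists_maximal_congruence {L : Type u} [BZAlgebra L] {a b : L} (hab : a ≠ b) :
    ∃ r : Setoid L, Maximal (fun r => IsCongruence r ∧ ¬ r a b) r := by
  refine (zorn_le_nonempty₀ {r : Setoid L | IsCongruence r ∧ ¬ r a b} ?_ ⊥ ?_).imp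
    fun _ h => h.2
  · intro C hC hchain r₀ hr₀
    obtain ⟨s, hs, hs'⟩ := IsCongruence.sSup_of_isChain hchain ⟨r₀, hr₀⟩ fun r hr => (hC hr).1
    refine ⟨s, ⟨hs, fun h => ?_⟩, fun r hr c d hcd => (hs' c d).2 ⟨r, hr, hcd⟩⟩
    obtain ⟨r, hr, h1⟩ := (hs' a b).1 h
    exact (hC hr).2 h1
  · refine ⟨⟨?_, ?_, ?_, ?_⟩, hab⟩
    · rintro a b c d rfl rfl; rfl
    · rintro a b c d rfl rfl; rfl
    · rintro a b rfl; rfl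
    · rintro a b rfl; rfl

/-- Distinct elements are separated by a homomorphism onto a directly indecomposable algebra. -/
theorem exists_directlyIndecomposable (A : Alg.{u}) {a b : A} (hab : a ≠ b) :
    ∃ (B : Alg.{u}) (f : Hom A B), Function.Surjective f ∧ f a ≠ f b ∧
      DirectlyIndecomposable B := by
  obtain ⟨r, ⟨hr, hrab⟩, hmax⟩ := exists_maximal_congruence hab
  let := hr.quotient
  refine ⟨Alg.mk (Quotient r), hr.mkHom, Quotient.mk_surjective,
    fun h => hrab (Quotient.exact h), fun M N g hg => ?_⟩
  -- By maximality of `r`, a homomorphism that separates the classes of `a` and `b` has trivial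
  -- kernel.
  have key : ∀ {K : Alg.{u}} (p : Hom (Quotient r) K), p (Quotient.mk r a) ≠ p (Quotient.mk r b) →
      Function.Injective p := by
    intro K p hp
    have h1 := hmax (y := Setoid.ker (p.comp hr.mkHom)) ⟨IsCongruence.ker _, hp⟩
      fun c d hcd => congrArg p (Quotient.sound hcd)
    rintro ⟨c⟩ ⟨d⟩ hcd
    exact Quotient.sound (h1 hcd)
  -- One projection separates the two classes and is thus injective; surjectivity of `g` then makes
  -- the other factor trivial.
  by_cases h1 : (g (Quotient.mk r a)).1 = (g (Quotient.mk r b)).1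
  · left
    have h2 : (g (Quotient.mk r a)).2 ≠ (g (Quotient.mk r b)).2 := fun h2 =>
      hrab (Quotient.exact (hg.1 (Prod.ext h1 h2)))
    have hinj := key (K := N) (Hom.snd.comp g) h2
    refine ⟨fun m m' => ?_⟩
    obtain ⟨c, hc⟩ := hg.2 (m, ⊥)
    obtain ⟨d, hd⟩ := hg.2 (m', ⊥)
    have hcd : c = d := hinj ((congrArg Prod.snd hc).trans (congrArg Prod.snd hd).symm)
    exact congrArg Prod.fst (hc.symm.trans (hcd ▸ hd))
  · right
    have hinj := key (K := M) (Hom.fst.comp g) h1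
    refine ⟨fun m m' => ?_⟩
    obtain ⟨c, hc⟩ := hg.2 (⊥, m)
    obtain ⟨d, hd⟩ := hg.2 (⊥, m')
    have hcd : c = d := hinj ((congrArg Prod.fst hc).trans (congrArg Prod.fst hd).symm)
    exact congrArg Prod.snd (hc.symm.trans (hcd ▸ hd))

/-- A variety is contained in any variety that contains its directly indecomposable members. -/
theorem IsVariety.subset_of_directlyIndecomposable {V W : Set Alg.{u}} (hV : IsVariety V)
    (hW : IsVariety W) (h : ∀ A ∈ V, DirectlyIndecomposable A → A ∈ W) : V ⊆ W := by
  intro A hA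
  choose B f hf hne hB using fun p : {p : A × A // p.1 ≠ p.2} =>
    exists_directlyIndecomposable A p.2
  refine hW.sub _ (hW.prod _ B fun p => h _ (hV.hom A hA _ (f p) (hf p)) (hB p)) A (Hom.pi f) ?_
  intro a b hab
  by_contra hn
  exact hne ⟨(a, b), hn⟩ (congrFun hab ⟨(a, b), hn⟩)

/-! ### The three varieties -/

theorem OML_subset_V2 : OML.{u} ⊆ V2.{u} := fun _ h =>
  ⟨h.1, h.1.j2_of_isOrtholattice h.2.toIsOrtholattice,
    h.1.sdm_of_isOrtholattice h.2.toIsOrtholattice⟩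

theorem V2_subset_V1 : V2.{u} ⊆ V1.{u} := fun _ h => ⟨h.1, h.2.1, h.2.2.wsdm⟩

theorem V3_subset_V1 : V3.{u} ⊆ V1.{u} := fun _ h => ⟨h.1, h.2.1, h.2.2.1⟩

theorem OML_subset_V3 : OML.{u} ⊆ V3.{u} := fun _ h =>
  ⟨h.1, h.1.j2_of_isOrtholattice h.2.toIsOrtholattice,
    (h.1.sdm_of_isOrtholattice h.2.toIsOrtholattice).wsdm,
    h.1.sk_of_isOrtholattice h.2.toIsOrtholattice⟩

theorem AOL_subset_V1 : AOL.{u} ⊆ V1.{u} := fun _ h =>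
  have h : IsAntiortholattice _ := h
  ⟨h.toIsPBZStarLattice, h.j2, h.wsdm⟩

theorem generatedVariety_AOL_subset_V1 : generatedVariety AOL.{u} ⊆ V1.{u} :=
  generatedVariety_subset isVariety_V1 AOL_subset_V1

theorem varietalJoin_subset {K₁ K₂ W : Set Alg.{u}} (hW : IsVariety W) (h₁ : K₁ ⊆ W)
    (h₂ : K₂ ⊆ W) : varietalJoin K₁ K₂ ⊆ W :=
  generatedVariety_subset hW (Set.union_subset h₁ h₂)

/-- The half common to the three equalities: only the antiortholattices of `V` remain to be placed.
-/
theorem subset_varietalJoin_of_subset_V1 {V K : Set Alg.{u}} (hV : IsVariety V)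
    (hV1 : V ⊆ V1.{u}) (h : ∀ A ∈ V, IsAntiortholattice A → A ∈ K) :
    V ⊆ varietalJoin OML.{u} K := by
  refine hV.subset_of_directlyIndecomposable (isVariety_generatedVariety _) fun A hA hd => ?_
  refine subset_generatedVariety _ ?_
  rcases isOrthomodularLattice_or_isAntiortholattice (hV1 hA) hd with ho | ha
  · exact Or.inl ⟨(hV1 hA).1, ho⟩
  · exact Or.inr (h A hA ha)

theorem V1_eq : V1.{u} = varietalJoin OML.{u} (generatedVariety AOL.{u}) :=
  (subset_varietalJoin_of_subset_V1 isVariety_V1 subset_rfl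
      fun _ _ ha => subset_generatedVariety _ ha).antisymm
    (varietalJoin_subset isVariety_V1 (OML_subset_V2.trans V2_subset_V1)
      generatedVariety_AOL_subset_V1)

theorem SAOL_subset_V2 : SAOL.{u} ⊆ V2.{u} := fun _ h =>
  have h1 : _ ∈ V1.{u} := generatedVariety_AOL_subset_V1 h.1
  ⟨h1.1, h1.2.1, h.2⟩

theorem V2_eq : V2.{u} = varietalJoin OML.{u} SAOL.{u} :=
  (subset_varietalJoin_of_subset_V1 (K := SAOL) isVariety_V2 V2_subset_V1
      fun _ hA ha => ⟨subset_generatedVariety _ ha, hA.2.2⟩).antisymm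
    (varietalJoin_subset isVariety_V2 OML_subset_V2 SAOL_subset_V2)

/-! ### The chain `D₃` and the antiortholattices satisfying SK -/

theorem isAntiortholattice_fin_three : IsAntiortholattice (Fin 3) where
  kc_kc := by decide
  kc_anti := by decide
  inf_kc_le_sup_kc := by decide
  inf_bc := by decide
  le_bc_bc := by decide
  bc_anti := by decide
  kc_bc := by decide
  star := by unfold box; decide
  paraorthomodular := by unfold IsParaorthomodular; decide
  kleeneSharp_eq := by
    ext a
    change a ⊓ kc a = ⊥ ↔ a = ⊥ ∨ a = ⊤
    revert a
    decide

theorem sk_fin_three : SK (Fin 3) := by unfold SK box dia; decide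

theorem IsAntiortholattice.ulift {L : Type v} [BZAlgebra L] (h : IsAntiortholattice L) :
    IsAntiortholattice (ULift.{u} L) where
  kc_kc a := congrArg ULift.up (h.kc_kc a.down)
  kc_anti a b := h.kc_anti a.down b.down
  inf_kc_le_sup_kc a b := h.inf_kc_le_sup_kc a.down b.down
  inf_bc a := congrArg ULift.up (h.inf_bc a.down)
  le_bc_bc a := h.le_bc_bc a.down
  bc_anti a b := h.bc_anti a.down b.down
  kc_bc a := congrArg ULift.up (h.kc_bc a.down)
  star a := h.star a.down
  paraorthomodular a b hab h0 :=
    congrArg ULift.up (h.paraorthomodular a.down b.down hab (congrArg ULift.down h0))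
  kleeneSharp_eq := by
    ext a
    constructor
    · intro ha
      exact (h.eq_bot_or_eq_top (congrArg ULift.down ha)).imp (congrArg ULift.up)
        (congrArg ULift.up)
    · rintro (rfl | rfl)
      · exact bot_inf_eq (kc (⊥ : ULift.{u} L))
      · exact congrArg ULift.up (show (⊤ : L) ⊓ kc ⊤ = ⊥ by rw [h.kc_top, inf_bot_eq])

theorem D3_mem_V3 : D3.{u} ∈ V3.{u} := by
  have h : IsAntiortholattice D3.{u} := isAntiortholattice_fin_three.ulift
  exact ⟨h.toIsPBZStarLattice, h.j2, h.wsdm, fun a b => sk_fin_three a.down b.down⟩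

/-- The middle element of `D₃`. -/
def midD3 : D3.{u} := ⟨1⟩

theorem midD3_ne_bot : midD3.{u} ≠ ⊥ := fun h => absurd (congrArg ULift.down h) (by decide)

theorem midD3_ne_top : midD3.{u} ≠ ⊤ := fun h => absurd (congrArg ULift.down h) (by decide)

theorem bot_ne_top_D3 : (⊥ : D3.{u}) ≠ ⊤ := fun h => absurd (congrArg ULift.down h) (by decide)

section

variable {L : Type u} [BZAlgebra L]

open Classical in
/-- The map onto `D₃` that collapses all elements other than `0` and `1`. -/
noncomputable def toD3 (a : L) : D3.{u} := if a = ⊥ then ⊥ else if a = ⊤ then ⊤ else midD3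

theorem toD3_bot : toD3 (⊥ : L) = ⊥ := if_pos rfl

theorem toD3_top [Nontrivial L] : toD3 (⊤ : L) = ⊤ := by
  rw [toD3, if_neg top_ne_bot, if_pos rfl]

theorem toD3_of_ne {a : L} (h₀ : a ≠ ⊥) (h₁ : a ≠ ⊤) : toD3 a = midD3 := by
  rw [toD3, if_neg h₀, if_neg h₁]

variable (h : IsAntiortholattice L) (hk : SK L)
include h hk

theorem IsAntiortholattice.eq_of_sk {a b : L} (ha₀ : a ≠ ⊥) (ha₁ : a ≠ ⊤) (hb₀ : b ≠ ⊥)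
    (hb₁ : b ≠ ⊤) : a = b :=
  le_antisymm (h.le_of_sk hk ha₁ hb₀) (h.le_of_sk hk hb₁ ha₀)

theorem IsAntiortholattice.kc_eq_of_sk {a : L} (ha₀ : a ≠ ⊥) (ha₁ : a ≠ ⊤) : kc a = a := by
  refine h.eq_of_sk hk (fun h0 => ha₁ ?_) (fun h0 => ha₀ ?_) ha₀ ha₁
  · rw [← h.kc_kc a, h0, h.kc_bot]
  · rw [← h.kc_kc a, h0, h.kc_top]

theorem toD3_injective [Nontrivial L] : Function.Injective (toD3 : L → D3.{u}) := by
  intro a b hab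
  by_cases ha₀ : a = ⊥ <;> by_cases ha₁ : a = ⊤ <;> by_cases hb₀ : b = ⊥ <;>
    by_cases hb₁ : b = ⊤ <;>
    first
      | exact h.eq_of_sk hk ha₀ ha₁ hb₀ hb₁
      | simp_all [toD3, midD3_ne_bot, midD3_ne_top, midD3_ne_bot.symm, midD3_ne_top.symm,
          bot_ne_top_D3, bot_ne_top_D3.symm]

/-- The embedding into `D₃` of a nontrivial antiortholattice that satisfies SK. -/
noncomputable def homD3 [Nontrivial L] : Hom L D3.{u} where
  toFun := toD3
  map_sup' a b := by
    by_cases ha₀ : a = ⊥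
    · rw [ha₀, toD3_bot, bot_sup_eq, bot_sup_eq]
    by_cases ha₁ : a = ⊤
    · rw [ha₁, toD3_top, top_sup_eq, top_sup_eq, toD3_top]
    by_cases hb₀ : b = ⊥
    · rw [hb₀, toD3_bot, sup_bot_eq, sup_bot_eq]
    by_cases hb₁ : b = ⊤
    · rw [hb₁, toD3_top, sup_top_eq, sup_top_eq, toD3_top]
    rw [h.eq_of_sk hk ha₀ ha₁ hb₀ hb₁, sup_idem, sup_idem]
  map_inf' a b := by
    by_cases ha₀ : a = ⊥
    · rw [ha₀, toD3_bot, bot_inf_eq, bot_inf_eq, toD3_bot]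
    by_cases ha₁ : a = ⊤
    · rw [ha₁, toD3_top, top_inf_eq, top_inf_eq]
    by_cases hb₀ : b = ⊥
    · rw [hb₀, toD3_bot, inf_bot_eq, inf_bot_eq, toD3_bot]
    by_cases hb₁ : b = ⊤
    · rw [hb₁, toD3_top, inf_top_eq, inf_top_eq]
    rw [h.eq_of_sk hk ha₀ ha₁ hb₀ hb₁, inf_idem, inf_idem]
  map_top' := toD3_top
  map_bot' := toD3_bot
  map_kc a := by
    by_cases ha₀ : a = ⊥
    · rw [ha₀, toD3_bot, h.kc_bot, toD3_top]
      rfl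
    by_cases ha₁ : a = ⊤
    · rw [ha₁, toD3_top, h.kc_top, toD3_bot]
      rfl
    rw [h.kc_eq_of_sk hk ha₀ ha₁, toD3_of_ne ha₀ ha₁]
    rfl
  map_bc a := by
    by_cases ha₀ : a = ⊥
    · rw [ha₀, toD3_bot, h.bc_bot, toD3_top]
      rfl
    rw [h.bc_eq_bot ha₀, toD3_bot]
    by_cases ha₁ : a = ⊤
    · rw [ha₁, toD3_top]
      rfl
    rw [toD3_of_ne ha₀ ha₁]
    rfl

end

theorem mem_generatedVariety_D3 {A : Alg.{u}} (h : IsAntiortholattice A) (hk : SK A) :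
    A ∈ generatedVariety {D3.{u}} := by
  have hV := isVariety_generatedVariety.{u} {D3}
  have hD : D3.{u} ∈ generatedVariety {D3.{u}} := subset_generatedVariety _ rfl
  rcases subsingleton_or_nontrivial A with hs | hn
  -- A trivial algebra does not embed in `D₃`, as `0 ≠ 1` there, but it is a quotient of it.
  · let f : Hom D3.{u} A :=
      { toFun := fun _ => ⊥
        map_sup' := fun _ _ => hs.elim _ _
        map_inf' := fun _ _ => hs.elim _ _
        map_top' := hs.elim _ _
        map_bot' := hs.elim _ _
        map_kc := fun _ => hs.elim _ _
        map_bc := fun _ => hs.elim _ _ }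
    exact hV.hom _ hD A f fun a => ⟨⊥, hs.elim _ _⟩
  · exact hV.sub _ hD A (homD3 h hk) (toD3_injective h hk)

theorem V3_eq : V3.{u} = varietalJoin OML.{u} (generatedVariety {D3.{u}}) :=
  (subset_varietalJoin_of_subset_V1 isVariety_V3 V3_subset_V1
      fun _ hA ha => mem_generatedVariety_D3 ha hA.2.2.2).antisymm
    (varietalJoin_subset isVariety_V3 OML_subset_V3
      (generatedVariety_subset isVariety_V3 (Set.singleton_subset_iff.2 D3_mem_V3)))

end BZAlgebra

theorem mainTheorem1 :
    (∀ A : BZAlgebra.Alg.{u}, A ∈ BZAlgebra.V1.{u} → BZAlgebra.DirectlyIndecomposable A →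
      BZAlgebra.IsOrthomodularLattice A ∨ BZAlgebra.IsAntiortholattice A) ∧
    BZAlgebra.V1.{u} = BZAlgebra.varietalJoin BZAlgebra.OML.{u}
      (BZAlgebra.generatedVariety BZAlgebra.AOL.{u}) ∧
    BZAlgebra.V2.{u} = BZAlgebra.varietalJoin BZAlgebra.OML.{u} BZAlgebra.SAOL.{u} ∧
    BZAlgebra.V3.{u} = BZAlgebra.varietalJoin BZAlgebra.OML.{u}
      (BZAlgebra.generatedVariety {BZAlgebra.D3.{u}}) :=
  ⟨fun _ => BZAlgebra.isOrthomodularLattice_or_isAntiortholattice, BZAlgebra.V1_eq, BZAlgebra.V2_eq,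
    BZAlgebra.V3_eq⟩
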